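/- Let $(M,F)$ be a Finsler surface: $M$ is a smooth surface and $F:TM\to[0,\infty)$ is $C^\infty$ off the zero section, satisfies $F(x,ry)=rF(x,y)$ for all $r>0$, and the matrix $g_{ij}(x,y)=\tfrac12\,\partial^2F^2/\partial y^i\partial y^j$ is positive definite for every $y\neq 0$. Let $\Sigma=\{(x,y)\in TM : F(x,y)=1\}$ be the indicatrix bundle. For $y\ne0$ let $e_2=y/F(x,y)$ and let $e_1=m^i\,\partial/\partial x^i$ be the vector such that $(e_1,e_2)$ is a positively oriented $g_{(x,y)}$-orthonormal basis of $T_xM$, where an orientation of each tangent plane has been fixed. Let $I=A(e_1,e_1,e_1)$ be the Cartan scalar, where $A_{ijk}=\tfrac{F}{2}\,\partial g_{ij}/\partial y^k$, and let $I_3=\hat e_3(I)$ be its vertical derivative, i.e. its derivative along the vertical vector field $\hat e_3=F\,m^i\,\partial/\partial y^i$; equivalently, for the coframe $(\omega^1,\omega^2,\omega^3)$ on $\Sigma$ to which $(\hat e_1,\hat e_2,\hat e_3)$ is dual, $dI=I_1\omega^1+I_2\omega^2+I_3\omega^3$. If $I_3$ is constant on all of $\Sigma$, then $I_3=0$ everywhere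 on $\Sigma$. -/

import Mathlib

open scoped Manifold ContDiff

/-- The fundamental tensor `g_y(v, w) = (1/2) ∂²(F²)(y + s v + t w)/∂s∂t` at `s = t = 0` of a
function `F` on a real vector space; in linear coordinates this is `g_ij v^i w^j` with
`g_ij = (1/2) ∂²F²/∂y^i∂y^j`. -/
noncomputable def fundamentalTensor {V : Type*} [AddCommGroup V] [Module ℝ V]
    (F : V → ℝ) (y v w : V) : ℝ :=
  (1 / 2) * lineDeriv ℝ (fun z => lineDeriv ℝ (fun p => F p ^ 2) z v) y w

/-- The Cartan tensor `A_y(v, w, z) = (F(y)/2) ∂ g_y(v, w)/∂y` in the direction `z`, that is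
`A_ijk = (F/2) ∂g_ij/∂y^k = (F/4) ∂³F²/∂y^i∂y^j∂y^k` in linear coordinates. -/
noncomputable def cartanTensor {V : Type*} [AddCommGroup V] [Module ℝ V]
    (F : V → ℝ) (y v w z : V) : ℝ :=
  F y / 2 * lineDeriv ℝ (fun p => fundamentalTensor F p v w) y z

/-- The first vector of the Berwald frame, computed in the coordinates of a basis `b`:
`e₁ = (1/√g) (∂F/∂y² b₁ - ∂F/∂y¹ b₂)`, where `g` is the determinant of the matrix `g_ij(y)`.
Together with `e₂ = y / F(y)` it is the `g_y`-orthonormal frame with the orientation of `b`. -/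
noncomputable def berwaldVector {V : Type*} [AddCommGroup V] [Module ℝ V]
    (F : V → ℝ) (b : Module.Basis (Fin 2) ℝ V) (y : V) : V :=
  (Real.sqrt (Matrix.of fun i j => fundamentalTensor F y (b i) (b j)).det)⁻¹ •
    (lineDeriv ℝ F y (b 1) • b 0 - lineDeriv ℝ F y (b 0) • b 1)

/-- A Finsler structure on a surface `M`: a function `F : TM → [0, ∞)` which is smooth off the
zero section and whose restriction to every tangent plane is a Minkowski norm (positively
homogeneous of degree one, with positive definite fundamental tensor off the origin).
Smoothness of each restriction off the origin is contained in `smooth`. -/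
structure FinslerStructure (M : Type*) [TopologicalSpace M]
    [ChartedSpace (EuclideanSpace ℝ (Fin 2)) M] [IsManifold (𝓡 2) ∞ M] where
  F : ∀ x : M, TangentSpace (𝓡 2) x → ℝ
  smooth : ContMDiffOn ((𝓡 2).tangent) 𝓘(ℝ, ℝ) ∞
    (fun u : TangentBundle (𝓡 2) M => F u.proj u.snd) {u | u.snd ≠ 0}
  nonneg : ∀ (x : M) (y : TangentSpace (𝓡 2) x), 0 ≤ F x y
  homogeneous : ∀ (x : M) (y : TangentSpace (𝓡 2) x) (r : ℝ), 0 < r → F x (r • y) = r * F x y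
  posDef : ∀ (x : M) (y v : TangentSpace (𝓡 2) x), y ≠ 0 → v ≠ 0 →
    0 < fundamentalTensor (F x) y v v

namespace FinslerStructure

theorem finiteDimensional_tangentSpace {M : Type*} [TopologicalSpace M]
    [ChartedSpace (EuclideanSpace ℝ (Fin 2)) M] (x : M) :
    FiniteDimensional ℝ (TangentSpace (𝓡 2) x) :=
  inferInstanceAs (FiniteDimensional ℝ (EuclideanSpace ℝ (Fin 2)))

theorem card_eq_finrank_tangentSpace {M : Type*} [TopologicalSpace M]
    [ChartedSpace (EuclideanSpace ℝ (Fin 2)) M] (x : M) :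
    Fintype.card (Fin 2) = Module.finrank ℝ (TangentSpace (𝓡 2) x) :=
  (finrank_euclideanSpace (𝕜 := ℝ) (ι := Fin 2)).symm

/-- A positively oriented basis of `T_xM` for a given orientation of this plane. -/
noncomputable def orientedBasis {M : Type*} [TopologicalSpace M]
    [ChartedSpace (EuclideanSpace ℝ (Fin 2)) M] (x : M)
    (ox : Orientation ℝ (TangentSpace (𝓡 2) x) (Fin 2)) :
    Module.Basis (Fin 2) ℝ (TangentSpace (𝓡 2) x) :=
  haveI := finiteDimensional_tangentSpace x
  ox.someBasis (card_eq_finrank_tangentSpace x)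

variable {M : Type*} [TopologicalSpace M] [ChartedSpace (EuclideanSpace ℝ (Fin 2)) M]
  [IsManifold (𝓡 2) ∞ M]

/-- The indicatrix bundle `Σ = {(x, y) ∈ TM | F(x, y) = 1}`. -/
def indicatrixBundle (S : FinslerStructure M) : Set (TangentBundle (𝓡 2) M) :=
  {u | S.F u.proj u.snd = 1}

/-- The vector `e₁` of the Berwald frame `{e₁, e₂ = y/F}` at `(x, y)`, the frame being positively
oriented for the orientation `o x` of `T_xM`. -/
noncomputable def e1 (S : FinslerStructure M)
    (o : ∀ x : M, Orientation ℝ (TangentSpace (𝓡 2) x) (Fin 2))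
    (x : M) (y : TangentSpace (𝓡 2) x) : TangentSpace (𝓡 2) x :=
  berwaldVector (S.F x) (orientedBasis x (o x)) y

/-- The Cartan scalar `I = A(e₁, e₁, e₁)`. -/
noncomputable def cartanScalar (S : FinslerStructure M)
    (o : ∀ x : M, Orientation ℝ (TangentSpace (𝓡 2) x) (Fin 2))
    (x : M) (y : TangentSpace (𝓡 2) x) : ℝ :=
  cartanTensor (S.F x) y (S.e1 o x y) (S.e1 o x y) (S.e1 o x y)

/-- The vertical derivative `I₃ = dI(ê₃)` of the Cartan scalar, the coefficient of `ω³` in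
`dI = I₁ ω¹ + I₂ ω² + I₃ ω³`. The vector `ê₃` of the frame dual to `(ω¹, ω², ω³)` is
`ê₃ = F m^i ∂/∂y^i` where `e₁ = m^i ∂/∂x^i`: it is vertical, hence killed by the
horizontal forms `ω¹` and `ω²`, and `ω³ = m_i δy^i / F` takes the value one on it. -/
noncomputable def cartanScalar3 (S : FinslerStructure M)
    (o : ∀ x : M, Orientation ℝ (TangentSpace (𝓡 2) x) (Fin 2))
    (u : TangentBundle (𝓡 2) M) : ℝ :=
  lineDeriv ℝ (S.cartanScalar o u.proj) u.snd (S.F u.proj u.snd • S.e1 o u.proj u.snd)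

end FinslerStructure

/-! The argument stays in one tangent plane. There `I` is continuous off the origin and positively
homogeneous of degree zero, so it attains on a compact sphere a maximum that is global on the
punctured plane. Rescaled to `F = 1`, the maximum point is critical for `I` in every direction, in
particular along `ê₃`. So `I₃` vanishes somewhere on each indicatrix, and a constant `I₃` is zero.
The core is `exists_lineDeriv_eq_zero_of_homogeneous`; the other lemmas supply the homogeneity and
continuity of `I`. -/

theorem lineDeriv_homogeneous {V : Type*} [AddCommGroup V] [Module ℝ V] {f : V → ℝ} {n : ℤ}
    (hf : ∀ (r : ℝ) (y : V), 0 < r → f (r • y) = r ^ n * f y) (v : V)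
    (r : ℝ) (y : V) (hr : 0 < r) :
    lineDeriv ℝ f (r • y) v = r ^ (n - 1) * lineDeriv ℝ f y v := by
  -- Rescaling the parameter `t` avoids any differentiability assumption on `f`.
  have h : (fun t : ℝ => f (r • y + t • v)) = fun t => r ^ n * f (y + (r⁻¹ * t) • v) := by
    funext t
    rw [← hf r _ hr, smul_add, smul_smul, mul_inv_cancel_left₀ hr.ne']
  rw [lineDeriv, h, deriv_const_mul_field,
    deriv_comp_mul_left r⁻¹ (fun t : ℝ => f (y + t • v)) 0, mul_zero, smul_eq_mul, ← mul_assoc,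
    zpow_sub_one₀ hr.ne', lineDeriv]

/-! ### Homogeneity of the tensors and of the frame. -/

section Homogeneity

variable {V : Type*} [AddCommGroup V] [Module ℝ V] {F : V → ℝ}

theorem fundamentalTensor_smul (hF : ∀ (r : ℝ) (y : V), 0 < r → F (r • y) = r * F y)
    (v w : V) (r : ℝ) (y : V) (hr : 0 < r) :
    fundamentalTensor F (r • y) v w = fundamentalTensor F y v w := by
  have h2 : ∀ (r : ℝ) (y : V), 0 < r → F (r • y) ^ 2 = r ^ (2 : ℤ) * F y ^ 2 := by
    intro r y hr
    rw [hF r y hr, mul_pow]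
    norm_cast
  have h1 := lineDeriv_homogeneous
    (f := fun p => lineDeriv ℝ (fun y => F y ^ 2) p v) (lineDeriv_homogeneous h2 v) w r y hr
  rw [fundamentalTensor, h1]
  norm_num [fundamentalTensor]

theorem cartanTensor_smul (hF : ∀ (r : ℝ) (y : V), 0 < r → F (r • y) = r * F y)
    (v w z : V) (r : ℝ) (y : V) (hr : 0 < r) :
    cartanTensor F (r • y) v w z = cartanTensor F y v w z := by
  have h0 : ∀ (r : ℝ) (y : V), 0 < r →
      fundamentalTensor F (r • y) v w = r ^ (0 : ℤ) * fundamentalTensor F y v w := by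
    intro r y hr
    rw [fundamentalTensor_smul hF v w r y hr, zpow_zero, one_mul]
  rw [cartanTensor, lineDeriv_homogeneous (f := fun p => fundamentalTensor F p v w) h0 z r y hr,
    hF r y hr, cartanTensor, zero_sub, zpow_neg_one]
  field_simp

theorem berwaldVector_smul (hF : ∀ (r : ℝ) (y : V), 0 < r → F (r • y) = r * F y)
    (b : Module.Basis (Fin 2) ℝ V) (r : ℝ) (y : V) (hr : 0 < r) :
    berwaldVector F b (r • y) = berwaldVector F b y := by
  have h1 : ∀ (r : ℝ) (y : V), 0 < r → F (r • y) = r ^ (1 : ℤ) * F y := by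
    simpa using hF
  have hd : ∀ v, lineDeriv ℝ F (r • y) v = lineDeriv ℝ F y v := by
    intro v
    simpa using lineDeriv_homogeneous h1 v r y hr
  simp only [berwaldVector, hd, fundamentalTensor_smul hF _ _ r y hr]

/-- Euler's relation `g_y(y, y) = F(y)²`. -/
theorem fundamentalTensor_self (hF : ∀ (r : ℝ) (y : V), 0 < r → F (r • y) = r * F y) (y : V) :
    fundamentalTensor F y y y = F y ^ 2 := by
  -- `F²` is quadratic along the ray through `y`. The first derivative is needed at all `a • y` near
  -- `y` so that it can be differentiated again.
  have key : ∀ a : ℝ, 0 < a → lineDeriv ℝ (fun p => F p ^ 2) (a • y) y = 2 * a * F y ^ 2 := by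
    intro a ha
    have hev : (fun t : ℝ => F (a • y + t • y) ^ 2) =ᶠ[nhds 0]
        fun t => (a + t) ^ 2 * F y ^ 2 := by
      filter_upwards [lt_mem_nhds (neg_lt_zero.2 ha)] with t ht
      rw [← add_smul, hF _ _ (by linarith), mul_pow]
    have hd : HasDerivAt (fun t : ℝ => (a + t) ^ 2 * F y ^ 2) (2 * a * F y ^ 2) 0 := by
      simpa using ((((hasDerivAt_id (0 : ℝ)).const_add a).pow 2).mul_const (F y ^ 2))
    rw [lineDeriv, hev.deriv_eq, hd.deriv]
  have hev : (fun t : ℝ => lineDeriv ℝ (fun p => F p ^ 2) (y + t • y) y) =ᶠ[nhds 0]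
      fun t => 2 * (1 + t) * F y ^ 2 := by
    filter_upwards [lt_mem_nhds (neg_lt_zero.2 one_pos)] with t ht
    rw [← key _ (by linarith), add_smul, one_smul]
  have hd : HasDerivAt (fun t : ℝ => 2 * (1 + t) * F y ^ 2) (2 * F y ^ 2) 0 := by
    simpa using ((((hasDerivAt_id (0 : ℝ)).const_add 1).const_mul 2).mul_const (F y ^ 2))
  rw [fundamentalTensor, lineDeriv, hev.deriv_eq, hd.deriv]
  ring

end Homogeneity

/-! ### Continuity off the origin and the critical point. -/

section Regularity

variable {V : Type*} [NormedAddCommGroup V] [NormedSpace ℝ V] {F : V → ℝ}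

theorem contDiffOn_fderiv_compl_zero {W : Type*} [NormedAddCommGroup W] [NormedSpace ℝ W]
    {f : V → W} (hf : ContDiffOn ℝ ∞ f {0}ᶜ) : ContDiffOn ℝ ∞ (fderiv ℝ f) {0}ᶜ :=
  hf.fderiv_of_isOpen isOpen_compl_singleton (by simp)

theorem differentiableAt_of_contDiffOn_compl_zero {W : Type*} [NormedAddCommGroup W]
    [NormedSpace ℝ W] {f : V → W} (hf : ContDiffOn ℝ ∞ f {0}ᶜ) {y : V} (hy : y ≠ 0) :
    DifferentiableAt ℝ f y :=
  (hf.contDiffAt (isOpen_compl_singleton.mem_nhds hy)).differentiableAt (by simp)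

theorem lineDeriv_congr_of_ne_zero {f g : V → ℝ} (h : ∀ p, p ≠ 0 → f p = g p) {y : V}
    (hy : y ≠ 0) (v : V) : lineDeriv ℝ f y v = lineDeriv ℝ g y v := by
  refine Filter.EventuallyEq.lineDeriv_eq ?_
  filter_upwards [isOpen_compl_singleton.mem_nhds hy] with p hp using h p hp

theorem fundamentalTensor_eq_fderiv (hF : ContDiffOn ℝ ∞ F {0}ᶜ) {y : V} (hy : y ≠ 0)
    (v w : V) : fundamentalTensor F y v w =
      1 / 2 * fderiv ℝ (fderiv ℝ fun p => F p ^ 2) y w v := by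
  have hG : ContDiffOn ℝ ∞ (fun p => F p ^ 2) {0}ᶜ := hF.pow 2
  have hd := differentiableAt_of_contDiffOn_compl_zero (contDiffOn_fderiv_compl_zero hG) hy
  rw [fundamentalTensor, lineDeriv_congr_of_ne_zero (fun p hp =>
    (differentiableAt_of_contDiffOn_compl_zero hG hp).lineDeriv_eq_fderiv) hy,
    (hd.clm_apply (differentiableAt_const v)).lineDeriv_eq_fderiv,
    fderiv_clm_apply hd (differentiableAt_const v)]
  simp

/-- Since `e₁` varies with `y`, continuity of `I` requires the tensor as a continuous map into
multilinear forms, not only for fixed arguments. -/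
theorem cartanTensor_eq_fderiv (hF : ContDiffOn ℝ ∞ F {0}ᶜ) {y : V} (hy : y ≠ 0)
    (v w z : V) : cartanTensor F y v w z =
      F y / 4 * fderiv ℝ (fderiv ℝ (fderiv ℝ fun p => F p ^ 2)) y z w v := by
  have hG : ContDiffOn ℝ ∞ (fun p => F p ^ 2) {0}ᶜ := hF.pow 2
  have hd := differentiableAt_of_contDiffOn_compl_zero
    (contDiffOn_fderiv_compl_zero (contDiffOn_fderiv_compl_zero hG)) hy
  have hw := hd.clm_apply (differentiableAt_const w)
  have hv := hw.clm_apply (differentiableAt_const v)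
  rw [cartanTensor, lineDeriv_congr_of_ne_zero (fun p hp =>
    fundamentalTensor_eq_fderiv hF hp v w) hy, (hv.const_mul (1 / 2)).lineDeriv_eq_fderiv,
    fderiv_const_mul hv, fderiv_clm_apply hw (differentiableAt_const v),
    fderiv_clm_apply hd (differentiableAt_const w)]
  simp
  ring

theorem det_fundamentalTensor_pos (hF : ContDiffOn ℝ ∞ F {0}ᶜ)
    (hpos : ∀ y v, y ≠ 0 → v ≠ 0 → 0 < fundamentalTensor F y v v)
    (b : Module.Basis (Fin 2) ℝ V) {y : V} (hy : y ≠ 0) :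
    0 < (Matrix.of fun i j => fundamentalTensor F y (b i) (b j)).det := by
  have hG : ContDiffOn ℝ ∞ (fun p => F p ^ 2) {0}ᶜ := hF.pow 2
  have hsymm : IsSymmSndFDerivAt ℝ (fun p => F p ^ 2) y :=
    (hG.contDiffAt (isOpen_compl_singleton.mem_nhds hy)).isSymmSndFDerivAt
      (by simpa using WithTop.coe_le_coe.2 (le_top : (2 : ℕ∞) ≤ ⊤))
  have h01 := hsymm (b 0) (b 1)
  have h1 := hpos y (b 1) hy (b.ne_zero 1)
  set g := fderiv ℝ (fderiv ℝ fun p => F p ^ 2) y with hg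
  -- With `g` the Hessian of `F²`, this vector `v` satisfies `g(v, v) = g(b 1, b 1) · det g`.
  have hv : g (b 1) (b 1) • b 0 - g (b 0) (b 1) • b 1 ≠ 0 := by
    intro h
    have := congrArg (fun v => b.repr v 0) h
    rw [fundamentalTensor_eq_fderiv hF hy, ← hg] at h1
    simp at this
    simp [this] at h1
  have h2 := hpos y _ hy hv
  simp only [fundamentalTensor_eq_fderiv hF hy, ← hg, map_sub, map_smul,
    sub_apply, smul_apply, smul_eq_mul] at h1 h2
  simp only [Matrix.det_fin_two, Matrix.of_apply,
    fundamentalTensor_eq_fderiv hF hy, ← hg]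
  rw [← h01] at h2 ⊢
  refine pos_of_mul_pos_right (a := g (b 1) (b 1)) ?_ (by linarith)
  linarith

theorem continuousOn_berwaldVector (hF : ContDiffOn ℝ ∞ F {0}ᶜ)
    (hpos : ∀ y v, y ≠ 0 → v ≠ 0 → 0 < fundamentalTensor F y v v)
    (b : Module.Basis (Fin 2) ℝ V) : ContinuousOn (berwaldVector F b) {0}ᶜ := by
  have hg : ∀ v w, ContinuousOn (fun y => fundamentalTensor F y v w) {0}ᶜ := by
    intro v w
    have h2 := (contDiffOn_fderiv_compl_zero
      (contDiffOn_fderiv_compl_zero (hF.pow 2))).continuousOn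
    exact (continuousOn_const.mul ((h2.clm_apply continuousOn_const).clm_apply
      continuousOn_const)).congr fun y hy => fundamentalTensor_eq_fderiv hF hy v w
  have hl : ∀ v, ContinuousOn (fun y => lineDeriv ℝ F y v) {0}ᶜ := by
    intro v
    exact ((contDiffOn_fderiv_compl_zero hF).continuousOn.clm_apply continuousOn_const).congr
      fun y hy => (differentiableAt_of_contDiffOn_compl_zero hF hy).lineDeriv_eq_fderiv
  refine ContinuousOn.smul (ContinuousOn.inv₀ (ContinuousOn.sqrt ?_) fun y hy =>
    (Real.sqrt_pos.2 (det_fundamentalTensor_pos hF hpos b hy)).ne')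
    (((hl _).smul continuousOn_const).sub ((hl _).smul continuousOn_const))
  simp only [Matrix.det_fin_two, Matrix.of_apply]
  exact ((hg _ _).mul (hg _ _)).sub ((hg _ _).mul (hg _ _))

theorem continuousOn_cartanTensor_apply (hF : ContDiffOn ℝ ∞ F {0}ᶜ) {e : V → V}
    (he : ContinuousOn e {0}ᶜ) :
    ContinuousOn (fun y => cartanTensor F y (e y) (e y) (e y)) {0}ᶜ := by
  have h3 := (contDiffOn_fderiv_compl_zero (contDiffOn_fderiv_compl_zero
    (contDiffOn_fderiv_compl_zero (hF.pow 2)))).continuousOn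
  exact ((hF.continuousOn.div_const 4).mul
    (((h3.clm_apply he).clm_apply he).clm_apply he)).congr
    fun y hy => cartanTensor_eq_fderiv hF hy _ _ _

/-- A continuous function on `V ∖ {0}` which is positively homogeneous of degree zero has a
critical point on the indicatrix of any positive function which is homogeneous of degree one. -/
theorem exists_lineDeriv_eq_zero_of_homogeneous [Nontrivial V] [ProperSpace V] {I : V → ℝ}
    (hI : ContinuousOn I {0}ᶜ) (hI0 : ∀ (r : ℝ) (y : V), 0 < r → I (r • y) = I y)
    (hF : ∀ (r : ℝ) (y : V), 0 < r → F (r • y) = r * F y) (hF0 : ∀ y, y ≠ 0 → 0 < F y) :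
    ∃ y, F y = 1 ∧ ∀ v, lineDeriv ℝ I y v = 0 := by
  obtain ⟨p, hp, hmax⟩ := (isCompact_sphere (0 : V) 1).exists_isMaxOn
    (NormedSpace.sphere_nonempty.2 zero_le_one)
    (hI.mono fun y hy => ne_zero_of_mem_unit_sphere ⟨y, hy⟩)
  have hp0 : p ≠ 0 := ne_zero_of_mem_unit_sphere ⟨p, hp⟩
  have hFp := inv_pos.2 (hF0 p hp0)
  refine ⟨(F p)⁻¹ • p, by rw [hF _ _ hFp, inv_mul_cancel₀ (hF0 p hp0).ne'], fun v => ?_⟩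
  -- A derivative that does not exist is zero by convention, so continuity of `I` suffices.
  refine IsLocalMax.deriv_eq_zero ?_
  have hc : Continuous fun t : ℝ => (F p)⁻¹ • p + t • v := by fun_prop
  filter_upwards [((isOpen_compl_singleton (x := (0 : V))).preimage hc).mem_nhds
    (x := 0) (by simpa using And.intro (hF0 p hp0).ne' hp0)] with t ht
  have hn := norm_pos_iff.2 (show (F p)⁻¹ • p + t • v ≠ 0 from ht)
  -- Degree zero lets both points be compared on the unit sphere, where `p` is maximal.
  rw [zero_smul, add_zero, hI0 _ _ hFp, ← hI0 _ _ (inv_pos.2 hn)]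
  refine hmax ?_
  rw [mem_sphere_zero_iff_norm, norm_smul, norm_inv, norm_norm, inv_mul_cancel₀ hn.ne']

/-- On a Minkowski plane the vertical derivative of the Cartan scalar vanishes somewhere on the
indicatrix. -/
theorem exists_lineDeriv_cartanTensor_berwaldVector_eq_zero [Nontrivial V] [ProperSpace V]
    (hF : ContDiffOn ℝ ∞ F {0}ᶜ) (hnonneg : ∀ y, 0 ≤ F y)
    (hhom : ∀ (r : ℝ) (y : V), 0 < r → F (r • y) = r * F y)
    (hpos : ∀ y v, y ≠ 0 → v ≠ 0 → 0 < fundamentalTensor F y v v)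
    (b : Module.Basis (Fin 2) ℝ V) :
    ∃ y, F y = 1 ∧ ∀ v, lineDeriv ℝ (fun y => cartanTensor F y (berwaldVector F b y)
      (berwaldVector F b y) (berwaldVector F b y)) y v = 0 := by
  refine exists_lineDeriv_eq_zero_of_homogeneous
    (continuousOn_cartanTensor_apply hF (continuousOn_berwaldVector hF hpos b)) ?_ hhom ?_
  · intro r y hr
    simp only [berwaldVector_smul hhom b r y hr, cartanTensor_smul hhom _ _ _ r y hr]
  · intro y hy
    refine (hnonneg y).lt_of_ne' fun h => ?_
    have := hpos y y hy hy
    rw [fundamentalTensor_self hhom, h] at this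
    simp at this

end Regularity

/-- The inclusion of a fibre into the tangent bundle is smooth. -/
theorem contMDiff_tangentSpace_inclusion {M : Type*} [TopologicalSpace M]
    [ChartedSpace (EuclideanSpace ℝ (Fin 2)) M] [IsManifold (𝓡 2) ∞ M] (x : M) :
    ContMDiff 𝓘(ℝ, EuclideanSpace ℝ (Fin 2)) ((𝓡 2).tangent) ∞
      (fun y : EuclideanSpace ℝ (Fin 2) => (⟨x, y⟩ : TangentBundle (𝓡 2) M)) := by
  intro y
  rw [Bundle.contMDiffAt_totalSpace]
  refine ⟨contMDiffAt_const, ?_⟩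
  -- In the trivialization centred at `x`, the coordinate change over `x` is the identity.
  have h : (fun y : EuclideanSpace ℝ (Fin 2) => (trivializationAt (EuclideanSpace ℝ (Fin 2))
      (TangentSpace (𝓡 2)) x (⟨x, y⟩ : TangentBundle (𝓡 2) M)).2) = id := by
    funext z
    exact (tangentBundleCore (𝓡 2) M).coordChange_self
      (achart (EuclideanSpace ℝ (Fin 2)) x) x (mem_chart_source _ x) z
  simp only [h]
  exact contMDiffAt_id

namespace FinslerStructure

theorem contDiffOn_fiber {M : Type*} [TopologicalSpace M]
    [ChartedSpace (EuclideanSpace ℝ (Fin 2)) M] [IsManifold (𝓡 2) ∞ M]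
    (S : FinslerStructure M) (x : M) :
    ContDiffOn ℝ ∞ (fun y : EuclideanSpace ℝ (Fin 2) => S.F x y) {0}ᶜ :=
  contMDiffOn_iff_contDiffOn.1
    (S.smooth.comp (contMDiff_tangentSpace_inclusion x).contMDiffOn fun _ hy => hy)

end FinslerStructure

theorem mainTheorem4 {M : Type*} [TopologicalSpace M]
    [ChartedSpace (EuclideanSpace ℝ (Fin 2)) M] [IsManifold (𝓡 2) ∞ M]
    (S : FinslerStructure M)
    (o : ∀ x : M, Orientation ℝ (TangentSpace (𝓡 2) x) (Fin 2))
    (c : ℝ) (hc : ∀ u ∈ S.indicatrixBundle, S.cartanScalar3 o u = c) :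
    ∀ u ∈ S.indicatrixBundle, S.cartanScalar3 o u = 0 := by
  intro u hu
  obtain ⟨y, hy, hy0⟩ := exists_lineDeriv_cartanTensor_berwaldVector_eq_zero
    (V := EuclideanSpace ℝ (Fin 2)) (S.contDiffOn_fiber u.proj) (S.nonneg u.proj)
    (fun r y => S.homogeneous u.proj y r) (S.posDef u.proj)
    (FinslerStructure.orientedBasis u.proj (o u.proj))
  -- Constancy moves the value from `u` to the critical point in the same fibre.
  rw [hc u hu, ← hc ⟨u.proj, y⟩ hy]
  exact hy0 _
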